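/- Write $[n]=\{1,\dots,n\}$ and let $\mathbf e_1,\dots,\mathbf e_n$ be the standard unit vectors. A polymatroid on $[n]$ is a set of the form $$P=\Big\{\mathbf a\in\mathbb Z^n : \sum_{i\in I}a_i\le f(I)\text{ for all } I\subseteq[n],\ \sum_{i\in[n]}a_i=f([n])\Big\},$$ where $f:2^{[n]}\to\mathbb Z$ satisfies $f(\emptyset)=0$ and $f(I)+f(J)\ge f(I\cup J)+f(I\cap J)$ for all $I,J\subseteq[n]$; such a set is finite. For $\mathbf a\in P$ let $$\mathrm{Int}_P(\mathbf a)=\{i\in[n] : \mathbf a-\mathbf e_i+\mathbf e_j\notin P\text{ for all } j<i\},\qquad \mathrm{Ext}_P(\mathbf a)=\{i\in[n] : \mathbf a+\mathbf e_i-\mathbf e_j\notin P\text{ for all } j<i\},$$ and define the interior and exterior polynomials of $P$ by $$I_P(x)=\sum_{\mathbf a\in P}x^{\,n-|\mathrm{Int}_P(\mathbf a)|},\qquad X_P(y)=\sum_{\mathbf a\in P}y^{\,n-|\mathrm{Ext}_P(\mathbf a)|}.$$ Theorem. Let $P$ and $P'$ be two polymatroids on the same ground set $[n]$. If $P'\subseteq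 P$, then $I_{P'}\le I_P$ and $X_{P'}\le X_P$, where $g_1\le g_2$ means that each coefficient of $g_1$ is less than or equal to the corresponding coefficient of $g_2$. -/

import Mathlib

open Polynomial

section

variable {ι : Type*}

/-- A set `P` of integer vectors indexed by the finite ground set `ι` is a polymatroid (more
precisely, the set of bases of an integer polymatroid) if it is cut out by some integer-valued
submodular rank function `f` with `f ∅ = 0`. -/
def IsPolymatroid [Fintype ι] [DecidableEq ι] (P : Set (ι → ℤ)) : Prop :=
  ∃ f : Finset ι → ℤ, f ∅ = 0 ∧
    (∀ I J : Finset ι, f (I ∪ J) + f (I ∩ J) ≤ f I + f J) ∧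
    P = {a | (∀ I : Finset ι, ∑ i ∈ I, a i ≤ f I) ∧ ∑ i, a i = f Finset.univ}

/-- A polymatroid is a finite set, so the sums over `P` below are genuine finite sums. -/
theorem IsPolymatroid.finite [Fintype ι] [DecidableEq ι] {P : Set (ι → ℤ)}
    (hP : IsPolymatroid P) : P.Finite := by
  obtain ⟨f, -, -, rfl⟩ := hP
  refine (Set.Finite.pi' (fun i : ι =>
    Set.finite_Icc (f Finset.univ - f (Finset.univ.erase i)) (f {i}))).subset ?_
  rintro a ⟨h1, h2⟩ i
  have h3 := h1 (Finset.univ.erase i)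
  have h4 := h1 {i}
  have h5 := Finset.add_sum_erase Finset.univ a (Finset.mem_univ i)
  rw [Finset.sum_singleton] at h4
  exact ⟨by linarith, h4⟩

variable [LinearOrder ι]

/-- The indices that are internally active with respect to the basis `a` of `P`
(`Pi.single i 1` is the `i`-th unit vector). -/
def internallyActive (P : Set (ι → ℤ)) (a : ι → ℤ) : Set ι :=
  {i | ∀ j < i, a - Pi.single i 1 + Pi.single j 1 ∉ P}

/-- The indices that are externally active with respect to the basis `a` of `P`. -/
def externallyActive (P : Set (ι → ℤ)) (a : ι → ℤ) : Set ι :=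
  {i | ∀ j < i, a + Pi.single i 1 - Pi.single j 1 ∉ P}

/-- The interior polynomial of `P`: the sum over the bases `a` of `x ^ (n - |Int(a)|)`, where `n`
is the size of the ground set. -/
noncomputable def interiorPolynomial [Fintype ι] (P : Set (ι → ℤ)) : ℤ[X] :=
  ∑ᶠ a ∈ P, X ^ (Fintype.card ι - (internallyActive P a).ncard)

/-- The exterior polynomial of `P`: the sum over the bases `a` of `y ^ (n - |Ext(a)|)`, where `n`
is the size of the ground set. -/
noncomputable def exteriorPolynomial [Fintype ι] (P : Set (ι → ℤ)) : ℤ[X] :=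
  ∑ᶠ a ∈ P, X ^ (Fintype.card ι - (externallyActive P a).ncard)

end

/-! ### Exchange sets and decomposition into slices. -/

section Exchange

variable {ι : Type*}

/-! Polymatroids have the exchange property (`IsPolymatroid.isExchangeSet`), and nothing else about
them is used. Negation turns interior activity into exterior activity, so exterior polynomials
suffice.

For the largest coordinate `i`, a basis is passive at `i` exactly when it lies below the top
`i`-slice. Hence the polynomial is a sum over slices, weighted by `X` except at the top
(`listPolynomial_cons`). If `Q ⊆ P` reach the same top height, the inequality follows slice by
slice, by induction on the number of coordinates.

Otherwise `Q` lies in `T`, which is `P` without its top `i`-slice, and induction on `P` compares `Q`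
with `T`. To compare `T` with `P`, another coordinate `j` is made the largest: the polynomial does
not depend on the order (`listPolynomial_perm`, reduced to two leading coordinates in
`listPolynomial_swap`), and deleting the top `i`-slice does not lower the top in direction `j` as
long as something remains (`exists_lt_of_truncate`). -/

/-- All elements of `P` agree in the coordinates outside `L`. -/
def ConstantOff (P : Finset (ι → ℤ)) (L : List ι) : Prop :=
  ∀ a ∈ P, ∀ b ∈ P, ∀ k, k ∉ L → a k = b k

/-- The elements of `P` whose coordinate `i` is `c`. -/
def slice (P : Finset (ι → ℤ)) (i : ι) (c : ℤ) : Finset (ι → ℤ) :=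
  P.filter fun a => a i = c

theorem mem_slice {P : Finset (ι → ℤ)} {i : ι} {c : ℤ} {a : ι → ℤ} :
    a ∈ slice P i c ↔ a ∈ P ∧ a i = c := by
  simp [slice]

theorem ConstantOff.mono {P Q : Finset (ι → ℤ)} {L : List ι} (hP : ConstantOff P L)
    (h : Q ⊆ P) : ConstantOff Q L :=
  fun a ha b hb => hP a (h ha) b (h hb)

theorem ConstantOff.perm {P : Finset (ι → ℤ)} {L L' : List ι} (hP : ConstantOff P L)
    (h : L.Perm L') : ConstantOff P L' :=
  fun a ha b hb k hk => hP a ha b hb k fun hk' => hk (h.mem_iff.1 hk')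

variable [DecidableEq ι]

/-- A finite set of integer vectors satisfying the exchange property of M-convex sets, in both
directions. -/
structure IsExchangeSet (P : Finset (ι → ℤ)) : Prop where
  up : ∀ a ∈ P, ∀ b ∈ P, ∀ i, a i < b i →
    ∃ j, b j < a j ∧ a + Pi.single i 1 - Pi.single j 1 ∈ P
  down : ∀ a ∈ P, ∀ b ∈ P, ∀ i, b i < a i →
    ∃ j, a j < b j ∧ a - Pi.single i 1 + Pi.single j 1 ∈ P

open Classical in
/-- The number of entries `i` of the list `L` for which `a` can be moved inside `P` by raising
coordinate `i` and lowering a coordinate that occurs later in `L`. -/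
noncomputable def passiveCount (P : Finset (ι → ℤ)) : List ι → (ι → ℤ) → ℕ
  | [], _ => 0
  | i :: L, a =>
    (if ∃ j ∈ L, a + Pi.single i 1 - Pi.single j 1 ∈ P then 1 else 0) + passiveCount P L a

/-- The exterior polynomial of `P` with respect to the coordinates in `L`, the head of the list
being the largest coordinate. -/
noncomputable def listPolynomial (P : Finset (ι → ℤ)) (L : List ι) : ℤ[X] :=
  ∑ a ∈ P, X ^ passiveCount P L a

theorem add_sub_single_apply_left {a : ι → ℤ} {i j : ι} (h : i ≠ j) :
    (a + Pi.single i 1 - Pi.single j 1 : ι → ℤ) i = a i + 1 := by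
  simp [h]

theorem add_sub_single_apply_right {a : ι → ℤ} {i j : ι} (h : i ≠ j) :
    (a + Pi.single i 1 - Pi.single j 1 : ι → ℤ) j = a j - 1 := by
  simp [h.symm]

theorem add_sub_single_apply_of_ne {a : ι → ℤ} {i j k : ι} (hi : k ≠ i) (hj : k ≠ j) :
    (a + Pi.single i 1 - Pi.single j 1 : ι → ℤ) k = a k := by
  simp [hi, hj]

theorem sub_add_single (a : ι → ℤ) (i j : ι) :
    a - Pi.single i 1 + Pi.single j 1 = a + Pi.single j 1 - Pi.single i 1 := by
  abel

theorem IsExchangeSet.neg {P Q : Finset (ι → ℤ)} (hP : IsExchangeSet P)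
    (hQ : ∀ a, a ∈ Q ↔ -a ∈ P) : IsExchangeSet Q := by
  constructor
  · intro a ha b hb i hi
    rw [hQ] at ha hb
    obtain ⟨j, hj, hm⟩ := hP.down _ ha _ hb i (by simpa using hi)
    refine ⟨j, by simpa using hj, (hQ _).2 ?_⟩
    convert hm using 1
    abel
  · intro a ha b hb i hi
    rw [hQ] at ha hb
    obtain ⟨j, hj, hm⟩ := hP.up _ ha _ hb i (by simpa using hi)
    refine ⟨j, by simpa using hj, (hQ _).2 ?_⟩
    convert hm using 1
    abel

/-- An exchange from `a` towards `b` keeps each coordinate between its values in `a` and `b`, so any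
interval condition on a coordinate survives. Slices and truncations are the two uses. -/
theorem IsExchangeSet.filter {P : Finset (ι → ℤ)} (hP : IsExchangeSet P) (i : ι)
    (p : ℤ → Prop) [DecidablePred p] (hp : ∀ x y z, p x → p z → x ≤ y → y ≤ z → p y) :
    IsExchangeSet (P.filter fun a => p (a i)) := by
  have key : ∀ a b : ι → ℤ, p (a i) → p (b i) → ∀ k j, a k < b k → b j < a j →
      p ((a + Pi.single k 1 - Pi.single j 1 : ι → ℤ) i) := by
    intro a b ha hb k j hk hj
    have hkj : k ≠ j := by rintro rfl; omega
    by_cases h1 : i = k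
    · subst h1
      rw [add_sub_single_apply_left hkj]
      exact hp _ _ _ ha hb (by omega) (by omega)
    · by_cases h2 : i = j
      · subst h2
        rw [add_sub_single_apply_right hkj]
        exact hp _ _ _ hb ha (by omega) (by omega)
      · rwa [add_sub_single_apply_of_ne h1 h2]
  constructor
  · intro a ha b hb k hk
    rw [Finset.mem_filter] at ha hb
    obtain ⟨j, hj, hm⟩ := hP.up a ha.1 b hb.1 k hk
    exact ⟨j, hj, Finset.mem_filter.2 ⟨hm, key a b ha.2 hb.2 k j hk hj⟩⟩
  · intro a ha b hb k hk
    rw [Finset.mem_filter] at ha hb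
    obtain ⟨j, hj, hm⟩ := hP.down a ha.1 b hb.1 k hk
    refine ⟨j, hj, Finset.mem_filter.2 ⟨hm, ?_⟩⟩
    rw [sub_add_single]
    exact key a b ha.2 hb.2 j k hj hk

theorem IsExchangeSet.isExchangeSet_slice {P : Finset (ι → ℤ)} (hP : IsExchangeSet P)
    (i : ι) (c : ℤ) :
    IsExchangeSet (slice P i c) :=
  hP.filter i (· = c) (by intros; omega)

theorem ConstantOff.constantOff_slice {P : Finset (ι → ℤ)} {i : ι} {L : List ι}
    (hP : ConstantOff P (i :: L)) (c : ℤ) : ConstantOff (slice P i c) L := by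
  intro a ha b hb k hk
  rw [mem_slice] at ha hb
  by_cases h : k = i
  · rw [h, ha.2, hb.2]
  · exact hP a ha.1 b hb.1 k (by simp [h, hk])

/-- The coordinate lowered by the exchange differs between two members of `P`, so it must belong to
`L`. -/
theorem IsExchangeSet.exists_move_iff {P : Finset (ι → ℤ)} (hP : IsExchangeSet P) {i : ι}
    {L : List ι} (hL : ConstantOff P (i :: L)) (hi : i ∉ L) {a : ι → ℤ} (ha : a ∈ P) :
    (∃ j ∈ L, a + Pi.single i 1 - Pi.single j 1 ∈ P) ↔ ∃ b ∈ P, a i < b i := by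
  constructor
  · rintro ⟨j, hj, hm⟩
    refine ⟨_, hm, ?_⟩
    rw [add_sub_single_apply_left (by rintro rfl; exact hi hj)]
    omega
  · rintro ⟨b, hb, hab⟩
    obtain ⟨j, hj, hm⟩ := hP.up a ha b hb i hab
    refine ⟨j, ?_, hm⟩
    by_contra hjL
    have hji : j ≠ i := by rintro rfl; omega
    have := hL a ha b hb j (by simp [hji, hjL])
    omega

open Classical in
theorem passiveCount_slice (P : Finset (ι → ℤ)) {i : ι} {L : List ι} (hi : i ∉ L) (a : ι → ℤ) :
    passiveCount (slice P i (a i)) L a = passiveCount P L a := by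
  suffices h : ∀ M : List ι, i ∉ M → passiveCount (slice P i (a i)) M a = passiveCount P M a from
    h L hi
  intro M hM
  induction M with
  | nil => rfl
  | cons k M ih =>
    rw [List.mem_cons, not_or] at hM
    have : (∃ j ∈ M, a + Pi.single k 1 - Pi.single j 1 ∈ slice P i (a i)) ↔
        ∃ j ∈ M, a + Pi.single k 1 - Pi.single j 1 ∈ P := by
      refine exists_congr fun j => and_congr_right fun hj => ?_
      rw [mem_slice, add_sub_single_apply_of_ne hM.1 (by rintro rfl; exact hM.2 hj)]
      simp
    rw [passiveCount, passiveCount, ih hM.2, if_congr this rfl rfl]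

open Classical in
/-- The contribution of the head coordinate is constant on its slices: it vanishes exactly on the
top slice. -/
theorem listPolynomial_cons {P : Finset (ι → ℤ)} (hP : IsExchangeSet P) {i : ι} {L : List ι}
    (hL : ConstantOff P (i :: L)) (hi : i ∉ L) :
    listPolynomial P (i :: L) = ∑ c ∈ P.image (fun a => a i),
      X ^ (if ∃ b ∈ P, c < b i then 1 else 0) * listPolynomial (slice P i c) L := by
  rw [listPolynomial, ← Finset.sum_fiberwise_of_maps_to
    (fun a ha => Finset.mem_image_of_mem (fun a : ι → ℤ => a i) ha)]
  refine Finset.sum_congr rfl fun c _ => ?_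
  rw [listPolynomial, Finset.mul_sum]
  refine Finset.sum_congr (by ext; simp [mem_slice]) fun a ha => ?_
  obtain ⟨haP, rfl⟩ := mem_slice.1 ha
  rw [passiveCount, pow_add, passiveCount_slice P hi,
    if_congr (hP.exists_move_iff hL hi haP) rfl rfl]

/-! ### Independence of the order of coordinates. -/

/-- Raising `i` while lowering a coordinate other than `j` would push the sum of coordinates `i` and
`j` above its maximum. -/
theorem IsExchangeSet.step_of_maximal {P : Finset (ι → ℤ)} (hP : IsExchangeSet P) {i j : ι}
    (hij : i ≠ j) {b : ι → ℤ} (hb : b ∈ P) (hmax : ∀ c ∈ P, c i + c j ≤ b i + b j)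
    (h : ∃ c ∈ P, b i < c i) : b + Pi.single i 1 - Pi.single j 1 ∈ P := by
  obtain ⟨c, hc, hbc⟩ := h
  obtain ⟨k, hk, hm⟩ := hP.up b hb c hc i hbc
  by_cases hkj : k = j
  · rwa [hkj] at hm
  · have hki : i ≠ k := by rintro rfl; omega
    have := hmax _ hm
    rw [add_sub_single_apply_left hki, add_sub_single_apply_of_ne hij.symm (Ne.symm hkj)] at this
    omega

/-- Among the vectors maximizing the sum of the coordinates `i` and `j` there is one that
dominates `a` in both coordinates and strictly in coordinate `i`. -/
theorem IsExchangeSet.exists_maximal_dominating {P : Finset (ι → ℤ)} (hP : IsExchangeSet P)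
    {i j : ι} (hij : i ≠ j) {a : ι → ℤ} (ha : a ∈ P) (hi : ∃ c ∈ P, a i < c i) (m : ℕ) :
    ∀ b ∈ P, (∀ c ∈ P, c i + c j ≤ b i + b j) → a i + a j < b i + b j →
      (b i - (a i + 1)).natAbs ≤ m → ∃ b ∈ P, a i < b i ∧ a j ≤ b j := by
  induction m with
  | zero =>
    intro b hb _ hlt hm
    exact ⟨b, hb, by omega, by omega⟩
  | succ m ih =>
    intro b hb hmax hlt hm
    -- Slide `b` along the maximizers towards height `a i + 1` in coordinate `i`; there the strict
    -- inequality of sums forces `a j ≤ b j`.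
    by_cases h1 : b i ≤ a i
    · obtain ⟨c, hc, hac⟩ := hi
      have hs := hP.step_of_maximal hij hb hmax ⟨c, hc, by omega⟩
      have e1 := add_sub_single_apply_left (a := b) hij
      have e2 := add_sub_single_apply_right (a := b) hij
      refine ih _ hs (fun d hd => ?_) (by omega) (by omega)
      have := hmax d hd
      omega
    · by_cases h2 : a j ≤ b j
      · exact ⟨b, hb, by omega, h2⟩
      · have hs := hP.step_of_maximal hij.symm hb (fun c hc => by have := hmax c hc; omega)
          ⟨a, ha, by omega⟩
        have e1 := add_sub_single_apply_left (a := b) hij.symm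
        have e2 := add_sub_single_apply_right (a := b) hij.symm
        refine ih _ hs (fun d hd => ?_) (by omega) (by omega)
        have := hmax d hd
        omega

/-- Away from the maximal sum of the coordinates `i` and `j`, coordinate `i` can be raised with `j`
fixed as soon as it can be raised at all. -/
theorem IsExchangeSet.exists_raise_iff {P : Finset (ι → ℤ)} (hP : IsExchangeSet P)
    {i j : ι} (hij : i ≠ j) {a : ι → ℤ} (ha : a ∈ P)
    (hsum : ∃ b ∈ P, a i + a j < b i + b j) :
    (∃ b ∈ slice P j (a j), a i < b i) ↔ ∃ b ∈ P, a i < b i := by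
  constructor
  · rintro ⟨b, hb, h⟩
    exact ⟨b, (mem_slice.1 hb).1, h⟩
  · intro hi
    obtain ⟨b₀, hb₀, hlt⟩ := hsum
    obtain ⟨b₁, hb₁, hmax⟩ := P.exists_max_image (fun b => b i + b j) ⟨a, ha⟩
    obtain ⟨b, hb, h1, h2⟩ := hP.exists_maximal_dominating hij ha hi _ b₁ hb₁ hmax
      (lt_of_lt_of_le hlt (hmax _ hb₀)) le_rfl
    -- Since `a j ≤ b j`, the exchange cannot lower `j`.
    obtain ⟨k, hk, hm⟩ := hP.up a ha b hb i h1
    have hkj : j ≠ k := by rintro rfl; omega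
    have hki : i ≠ k := by rintro rfl; omega
    refine ⟨_, mem_slice.2 ⟨hm, add_sub_single_apply_of_ne hij.symm hkj⟩, ?_⟩
    rw [add_sub_single_apply_left hki]
    omega

open Classical in
theorem passiveCount_congr {P : Finset (ι → ℤ)} {a b : ι → ℤ} (L : List ι)
    (h : ∀ k ∈ L, ∀ l ∈ L, a + Pi.single k 1 - Pi.single l 1 ∈ P ↔
      b + Pi.single k 1 - Pi.single l 1 ∈ P) :
    passiveCount P L a = passiveCount P L b := by
  induction L with
  | nil => rfl
  | cons i L ih =>
    have : (∃ j ∈ L, a + Pi.single i 1 - Pi.single j 1 ∈ P) ↔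
        ∃ j ∈ L, b + Pi.single i 1 - Pi.single j 1 ∈ P :=
      exists_congr fun j => and_congr_right fun hj =>
        h i List.mem_cons_self j (List.mem_cons_of_mem _ hj)
    rw [passiveCount, passiveCount, if_congr this rfl rfl,
      ih fun k hk l hl => h k (List.mem_cons_of_mem _ hk) l (List.mem_cons_of_mem _ hl)]

/-- Moves within `L` preserve coordinates `i` and `j`, so they keep the sum maximal and commute with
the step between `i` and `j`, which `step_of_maximal` allows in either direction. -/
theorem IsExchangeSet.passiveCount_step {P : Finset (ι → ℤ)} (hP : IsExchangeSet P) {i j : ι}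
    (hij : i ≠ j) {L : List ι} (hi : i ∉ L) (hj : j ∉ L) {b : ι → ℤ} (hb : b ∈ P)
    (hmax : ∀ c ∈ P, c i + c j ≤ b i + b j) (h : ∃ c ∈ P, b i < c i) :
    passiveCount P L (b + Pi.single i 1 - Pi.single j 1) = passiveCount P L b := by
  have hs := hP.step_of_maximal hij hb hmax h
  have e1 := add_sub_single_apply_left (a := b) hij
  have e2 := add_sub_single_apply_right (a := b) hij
  refine passiveCount_congr L fun k hk l hl => ?_
  have hik : i ≠ k := by rintro rfl; exact hi hk
  have hil : i ≠ l := by rintro rfl; exact hi hl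
  have hjk : j ≠ k := by rintro rfl; exact hj hk
  have hjl : j ≠ l := by rintro rfl; exact hj hl
  constructor
  · intro hm
    have f1 := add_sub_single_apply_of_ne (a := b + Pi.single i 1 - Pi.single j 1) hik hil
    have f2 := add_sub_single_apply_of_ne (a := b + Pi.single i 1 - Pi.single j 1) hjk hjl
    have := hP.step_of_maximal hij.symm hm
      (fun c hc => by have := hmax c hc; omega) ⟨b, hb, by omega⟩
    convert this using 1
    abel
  · intro hm
    have f1 := add_sub_single_apply_of_ne (a := b) hik hil
    have f2 := add_sub_single_apply_of_ne (a := b) hjk hjl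
    obtain ⟨c, hc, hbc⟩ := h
    have := hP.step_of_maximal hij hm
      (fun c hc => by have := hmax c hc; omega) ⟨c, hc, by omega⟩
    convert this using 1
    abel

open Classical in
theorem IsExchangeSet.passiveCount_cons_cons {P : Finset (ι → ℤ)} (hP : IsExchangeSet P)
    {i j : ι} {L : List ι} (hL : ConstantOff P (i :: j :: L)) (hij : i ≠ j) (hi : i ∉ L)
    (hj : j ∉ L) {a : ι → ℤ} (ha : a ∈ P) :
    passiveCount P (i :: j :: L) a = (if ∃ b ∈ P, a i < b i then 1 else 0) +
      ((if ∃ b ∈ slice P i (a i), a j < b j then 1 else 0) + passiveCount P L a) := by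
  have hi' : i ∉ j :: L := by simp [hij, hi]
  have h1 := hP.exists_move_iff hL hi' ha
  have ha' : a ∈ slice P i (a i) := mem_slice.2 ⟨ha, rfl⟩
  have h2 := (hP.isExchangeSet_slice i (a i)).exists_move_iff (hL.constantOff_slice (a i)) hj ha'
  rw [passiveCount, ← passiveCount_slice P hi', passiveCount, passiveCount_slice P hi,
    if_congr h1 rfl rfl, if_congr h2 rfl rfl]

/-- Among the vectors maximizing the sum of two coordinates, a step along the difference of these
coordinates exchanges those not maximal in the first with those not maximal in the second. -/
theorem IsExchangeSet.sum_maximal_step {P : Finset (ι → ℤ)} (hP : IsExchangeSet P) {i j : ι}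
    (hij : i ≠ j) {L : List ι} (hi : i ∉ L) (hj : j ∉ L) (Q : Finset (ι → ℤ))
    (hQ : ∀ a, a ∈ Q ↔ a ∈ P ∧ ∀ c ∈ P, c i + c j ≤ a i + a j)
    [DecidablePred fun a : ι → ℤ => ∃ b ∈ P, a i < b i]
    [DecidablePred fun a : ι → ℤ => ∃ b ∈ P, a j < b j] :
    ∑ a ∈ Q with ∃ b ∈ P, a i < b i, (X : ℤ[X]) ^ passiveCount P L a =
      ∑ a ∈ Q with ∃ b ∈ P, a j < b j, X ^ passiveCount P L a := by
  refine Finset.sum_bij' (fun a _ => a + Pi.single i 1 - Pi.single j 1)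
    (fun a _ => a + Pi.single j 1 - Pi.single i 1) ?_ ?_ ?_ ?_ ?_
  · intro a ha
    obtain ⟨haQ, hc⟩ := Finset.mem_filter.1 ha
    obtain ⟨haP, hmax⟩ := (hQ a).1 haQ
    have e1 := add_sub_single_apply_left (a := a) hij
    have e2 := add_sub_single_apply_right (a := a) hij
    refine Finset.mem_filter.2 ⟨(hQ _).2 ⟨hP.step_of_maximal hij haP hmax hc, fun d hd => ?_⟩,
      a, haP, by omega⟩
    have := hmax d hd
    omega
  · intro a ha
    obtain ⟨haQ, hc⟩ := Finset.mem_filter.1 ha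
    obtain ⟨haP, hmax⟩ := (hQ a).1 haQ
    have e1 := add_sub_single_apply_left (a := a) hij.symm
    have e2 := add_sub_single_apply_right (a := a) hij.symm
    refine Finset.mem_filter.2 ⟨(hQ _).2 ⟨hP.step_of_maximal hij.symm haP
      (fun d hd => by have := hmax d hd; omega) hc, fun d hd => ?_⟩, a, haP, by omega⟩
    have := hmax d hd
    omega
  · intro a _
    abel
  · intro a _
    abel
  · intro a ha
    obtain ⟨haQ, hc⟩ := Finset.mem_filter.1 ha
    obtain ⟨haP, hmax⟩ := (hQ a).1 haQ
    rw [hP.passiveCount_step hij hi hj haP hmax hc]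

/-- Below the maximal sum of coordinates `i` and `j`, exponents agree basis by basis. At the maximal
sum they need not, but the unit step from `j` to `i` matches the two sums. -/
theorem IsExchangeSet.listPolynomial_swap {P : Finset (ι → ℤ)} (hP : IsExchangeSet P) {i j : ι}
    {L : List ι} (hL : ConstantOff P (i :: j :: L)) (hij : i ≠ j) (hi : i ∉ L) (hj : j ∉ L) :
    listPolynomial P (i :: j :: L) = listPolynomial P (j :: i :: L) := by
  classical
  have hL' : ConstantOff P (j :: i :: L) := hL.perm (List.Perm.swap _ _ _)
  rw [listPolynomial, listPolynomial,
    ← Finset.sum_filter_add_sum_filter_not P (fun a => ∃ b ∈ P, a i + a j < b i + b j),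
    ← Finset.sum_filter_add_sum_filter_not P (fun a => ∃ b ∈ P, a i + a j < b i + b j)
      (fun a => X ^ passiveCount P (j :: i :: L) a)]
  congr 1
  · refine Finset.sum_congr rfl fun a ha => ?_
    obtain ⟨ha, hsum⟩ := Finset.mem_filter.1 ha
    rw [hP.passiveCount_cons_cons hL hij hi hj ha,
      hP.passiveCount_cons_cons hL' hij.symm hj hi ha]
    have h1 := hP.exists_raise_iff hij ha hsum
    have h2 := hP.exists_raise_iff hij.symm ha (by simpa only [add_comm] using hsum)
    simp only [h1, h2]
    rw [Nat.add_left_comm]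
  · set Q := P.filter fun a => ¬ ∃ b ∈ P, a i + a j < b i + b j with hQ
    have hmem : ∀ a, a ∈ Q ↔ a ∈ P ∧ ∀ c ∈ P, c i + c j ≤ a i + a j := by
      intro a
      simp [hQ]
    have expand : ∀ i j : ι, i ≠ j → i ∉ L → j ∉ L → ConstantOff P (i :: j :: L) →
        (∀ a ∈ Q, ∀ c ∈ P, c i + c j ≤ a i + a j) →
        ∑ a ∈ Q, (X : ℤ[X]) ^ passiveCount P (i :: j :: L) a = ∑ a ∈ Q, X ^ passiveCount P L a +
          (X - 1) * ∑ a ∈ Q with ∃ b ∈ P, a i < b i, X ^ passiveCount P L a := by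
      intro i j hij hi hj hL hmax
      rw [Finset.sum_filter (s := Q), Finset.mul_sum, ← Finset.sum_add_distrib]
      refine Finset.sum_congr rfl fun a ha => ?_
      rw [hP.passiveCount_cons_cons hL hij hi hj ((hmem a).1 ha).1]
      -- With `i` fixed, raising `j` would exceed the maximal sum; only the leading coordinate
      -- contributes.
      have h0 : ¬ ∃ b ∈ slice P i (a i), a j < b j := by
        rintro ⟨b, hb, hlt⟩
        obtain ⟨hb, hbi⟩ := mem_slice.1 hb
        have := hmax a ha b hb
        omega
      rw [if_neg h0]
      split_ifs
      · ring
      · ring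
    rw [expand i j hij hi hj hL fun a ha => ((hmem a).1 ha).2,
      expand j i hij.symm hj hi hL' fun a ha c hc => by
        have := ((hmem a).1 ha).2 c hc
        omega,
      hP.sum_maximal_step hij hi hj Q hmem]

/-- The polynomial does not depend on the order of the coordinates. -/
theorem IsExchangeSet.listPolynomial_perm {L L' : List ι} (h : L.Perm L') :
    ∀ {P : Finset (ι → ℤ)}, IsExchangeSet P → L.Nodup → ConstantOff P L →
      listPolynomial P L = listPolynomial P L' := by
  induction h with
  | nil => intros; rfl
  | cons i h ih =>
    intro P hP hn hL
    have hn' := List.nodup_cons.1 hn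
    rw [listPolynomial_cons hP hL hn'.1,
      listPolynomial_cons hP (hL.perm (h.cons i)) (fun hi => hn'.1 (h.mem_iff.2 hi))]
    exact Finset.sum_congr rfl fun c _ => by
      rw [ih (hP.isExchangeSet_slice i c) hn'.2 (hL.constantOff_slice c)]
  | swap i j L =>
    intro P hP hn hL
    simp only [List.nodup_cons, List.mem_cons, not_or] at hn
    exact hP.listPolynomial_swap hL hn.1.1 hn.1.2 hn.2.1
  | trans h₁ _ ih₁ ih₂ =>
    intro P hP hn hL
    rw [ih₁ hP hn hL, ih₂ hP (h₁.nodup_iff.1 hn) (hL.perm h₁)]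

/-! ### Monotonicity for exchange sets. -/

theorem coeff_listPolynomial_nonneg (P : Finset (ι → ℤ)) (L : List ι) (k : ℕ) :
    0 ≤ (listPolynomial P L).coeff k := by
  rw [listPolynomial, finsetSum_coeff]
  refine Finset.sum_nonneg fun a _ => ?_
  rw [coeff_X_pow]
  split_ifs <;> simp

theorem coeff_X_pow_mul_le {p q : ℤ[X]} (h : ∀ k, p.coeff k ≤ q.coeff k) (m k : ℕ) :
    (X ^ m * p).coeff k ≤ (X ^ m * q).coeff k := by
  rw [coeff_X_pow_mul', coeff_X_pow_mul']
  split_ifs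
  · exact h _
  · exact le_rfl

/-- Monotonicity passes from the slices to the whole set when the top slices of the two sets are at
the same height. -/
theorem coeff_listPolynomial_cons_le {P Q : Finset (ι → ℤ)} (hP : IsExchangeSet P)
    (hQ : IsExchangeSet Q) (hQP : Q ⊆ P) {i : ι} {L : List ι} (hL : ConstantOff P (i :: L))
    (hi : i ∉ L) (htop : ∀ a ∈ Q, (∃ b ∈ P, a i < b i) → ∃ b ∈ Q, a i < b i)
    (hslice : ∀ c k, (listPolynomial (slice Q i c) L).coeff k ≤
      (listPolynomial (slice P i c) L).coeff k) (k : ℕ) :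
    (listPolynomial Q (i :: L)).coeff k ≤ (listPolynomial P (i :: L)).coeff k := by
  classical
  rw [listPolynomial_cons hP hL hi, listPolynomial_cons hQ (hL.mono hQP) hi, finsetSum_coeff,
    finsetSum_coeff]
  refine (Finset.sum_le_sum fun c hc => ?_).trans
    (Finset.sum_le_sum_of_subset_of_nonneg (Finset.image_subset_image hQP) fun c _ _ => ?_)
  · obtain ⟨a, ha, rfl⟩ := Finset.mem_image.1 hc
    have : (∃ b ∈ Q, a i < b i) ↔ ∃ b ∈ P, a i < b i :=
      ⟨fun ⟨b, hb, h⟩ => ⟨b, hQP hb, h⟩, htop a ha⟩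
    simp only [this]
    exact coeff_X_pow_mul_le (hslice _) _ _
  · rw [coeff_X_pow_mul']
    generalize (if ∃ b ∈ P, c < b i then 1 else 0 : ℕ) = m
    split_ifs
    · exact coeff_listPolynomial_nonneg _ _ _
    · exact le_rfl

/-- Removing the top slice does not change the top of any other coordinate. -/
theorem IsExchangeSet.exists_lt_of_truncate {P : Finset (ι → ℤ)} (hP : IsExchangeSet P)
    {i j : ι} (hij : i ≠ j) {m : ℤ} (hm : ∀ b ∈ P, b i ≤ m) {a : ι → ℤ}
    (ha : a ∈ P.filter fun a => a i < m) (h : ∃ b ∈ P, a j < b j) :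
    ∃ b ∈ P.filter (fun a => a i < m), a j < b j := by
  obtain ⟨b, hb, hab⟩ := h
  obtain ⟨haP, ham⟩ := Finset.mem_filter.1 ha
  by_cases hbm : b i < m
  · exact ⟨b, Finset.mem_filter.2 ⟨hb, hbm⟩, hab⟩
  · have hbm' := hm b hb
    -- Lower `b` out of the top slice towards `a`; the coordinate raised is one where `b` is below
    -- `a`, hence not `j`, so `b j` is kept.
    obtain ⟨k, hk, hmem⟩ := hP.down b hb a haP i (by omega)
    rw [sub_add_single] at hmem
    have hki : k ≠ i := by rintro rfl; omega
    have hkj : j ≠ k := by rintro rfl; omega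
    refine ⟨_, Finset.mem_filter.2 ⟨hmem, ?_⟩, ?_⟩
    · rw [add_sub_single_apply_right hki]
      omega
    · rwa [add_sub_single_apply_of_ne hkj hij.symm]

/-- Monotonicity, for the exterior polynomials of exchange sets. -/
theorem IsExchangeSet.coeff_listPolynomial_mono (n : ℕ) :
    ∀ L : List ι, L.length = n → L.Nodup → ∀ P Q : Finset (ι → ℤ), IsExchangeSet P →
      IsExchangeSet Q → Q ⊆ P → ConstantOff P L →
      ∀ k, (listPolynomial Q L).coeff k ≤ (listPolynomial P L).coeff k := by
  induction n with
  | zero =>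
    intro L hn _ P Q _ _ hQP _ k
    rw [List.length_eq_zero_iff] at hn
    subst hn
    rw [listPolynomial, listPolynomial, finsetSum_coeff, finsetSum_coeff]
    refine Finset.sum_le_sum_of_subset_of_nonneg hQP fun a _ _ => ?_
    rw [coeff_X_pow]
    split_ifs <;> simp
  | succ n ih =>
    intro L hn hnd P
    have hslices : ∀ i M, (i :: M).length = n + 1 → (i :: M).Nodup →
        ∀ P Q : Finset (ι → ℤ), IsExchangeSet P → IsExchangeSet Q → Q ⊆ P →
        ConstantOff P (i :: M) → (∀ a ∈ Q, (∃ b ∈ P, a i < b i) → ∃ b ∈ Q, a i < b i) →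
        ∀ k, (listPolynomial Q (i :: M)).coeff k ≤ (listPolynomial P (i :: M)).coeff k := by
      intro i M hn hnd P Q hP hQ hQP hL htop
      rw [List.nodup_cons] at hnd
      exact coeff_listPolynomial_cons_le hP hQ hQP hL hnd.1 htop fun c =>
        ih M (by simpa using hn) hnd.2 _ _ (hP.isExchangeSet_slice i c)
          (hQ.isExchangeSet_slice i c) (Finset.filter_subset_filter _ hQP)
          (hL.constantOff_slice c)
    induction P using Finset.strongInduction with
    | H P ihP =>
      intro Q hP hQ hQP hL k
      obtain ⟨i, M, rfl⟩ := List.exists_cons_of_length_eq_add_one hn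
      by_cases htop : ∀ a ∈ Q, (∃ b ∈ P, a i < b i) → ∃ b ∈ Q, a i < b i
      · exact hslices i M hn hnd P Q hP hQ hQP hL htop k
      · push Not at htop
        obtain ⟨a, haQ, ⟨b, hb, hab⟩, hmaxQ⟩ := htop
        obtain ⟨t, ht, hmax⟩ := P.exists_max_image (fun c => c i) ⟨b, hb⟩
        have hbt := hmax b hb
        set T := P.filter fun c => c i < t i with hT
        have hTP : T ⊆ P := Finset.filter_subset _ _
        have hTE : IsExchangeSet T := hP.filter i (· < t i) (by intros; omega)
        have hQT : Q ⊆ T := fun c hc =>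
          Finset.mem_filter.2 ⟨hQP hc, by have := hmaxQ c hc; omega⟩
        have hTss : T ⊂ P := Finset.ssubset_iff_subset_ne.2 ⟨hTP, by
          intro h
          rw [← h, hT] at ht
          exact lt_irrefl _ (Finset.mem_filter.1 ht).2⟩
        refine (ihP T hTss Q hTE hQ hQT (hL.mono hTP) k).trans ?_
        have hi : i ∉ M := (List.nodup_cons.1 hnd).1
        cases M with
        | nil =>
          obtain ⟨j, hj, -⟩ := (hP.exists_move_iff hL hi (hQP haQ)).2 ⟨b, hb, hab⟩
          simp at hj
        | cons j M =>
          have hij : i ≠ j := by rintro rfl; simp at hi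
          have hperm : (i :: j :: M).Perm (j :: i :: M) := List.Perm.swap _ _ _
          -- With `j` leading, `T` and `P` have tops at the same height, so the slicewise comparison
          -- applies.
          rw [listPolynomial_perm hperm hTE hnd (hL.mono hTP),
            listPolynomial_perm hperm hP hnd hL]
          exact hslices j (i :: M) (by simpa using hn) (hperm.nodup_iff.1 hnd) P T hP hTE hTP
            (hL.perm hperm) (fun c hc h => hP.exists_lt_of_truncate hij hmax hc h) k

/-! ### Passive counts as cardinalities. -/

open Classical in
theorem passiveCount_eq_card [LinearOrder ι] (P : Finset (ι → ℤ)) (a : ι → ℤ) {L : List ι}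
    (hL : L.Pairwise (· > ·)) :
    passiveCount P L a = (L.toFinset.filter fun i =>
      ∃ j ∈ L, j < i ∧ a + Pi.single i 1 - Pi.single j 1 ∈ P).card := by
  induction L with
  | nil => simp [passiveCount]
  | cons i L ih =>
    rw [List.pairwise_cons] at hL
    have hi : i ∉ L := fun h => lt_irrefl _ (hL.1 i h)
    have h1 : (∃ j ∈ i :: L, j < i ∧ a + Pi.single i 1 - Pi.single j 1 ∈ P) ↔
        ∃ j ∈ L, a + Pi.single i 1 - Pi.single j 1 ∈ P := by
      constructor
      · rintro ⟨j, hj, hji, hm⟩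
        exact ⟨j, (List.mem_cons.1 hj).resolve_left hji.ne, hm⟩
      · rintro ⟨j, hj, hm⟩
        exact ⟨j, List.mem_cons_of_mem _ hj, hL.1 j hj, hm⟩
    have h2 : (L.toFinset.filter fun k =>
        ∃ j ∈ i :: L, j < k ∧ a + Pi.single k 1 - Pi.single j 1 ∈ P) = L.toFinset.filter fun k =>
        ∃ j ∈ L, j < k ∧ a + Pi.single k 1 - Pi.single j 1 ∈ P := by
      refine Finset.filter_congr fun k hk => ?_
      rw [List.mem_toFinset] at hk
      constructor
      · rintro ⟨j, hj, hjk, hm⟩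
        exact ⟨j, (List.mem_cons.1 hj).resolve_left (hjk.trans (hL.1 k hk)).ne, hjk, hm⟩
      · rintro ⟨j, hj, hjk⟩
        exact ⟨j, List.mem_cons_of_mem _ hj, hjk⟩
    rw [passiveCount, ih hL.2, List.toFinset_cons, Finset.filter_insert, h2, if_congr h1 rfl rfl]
    split_ifs
    · rw [Finset.card_insert_of_notMem (by simp [hi]), add_comm]
    · rw [zero_add]

end Exchange

/-! ### Polymatroids are exchange sets. -/

section Polymatroid

variable {ι : Type*} [DecidableEq ι]

theorem tight_union_inter {f : Finset ι → ℤ}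
    (hf : ∀ I J : Finset ι, f (I ∪ J) + f (I ∩ J) ≤ f I + f J) {a : ι → ℤ}
    (ha : ∀ I : Finset ι, ∑ i ∈ I, a i ≤ f I) {I J : Finset ι} (hI : ∑ i ∈ I, a i = f I)
    (hJ : ∑ i ∈ J, a i = f J) :
    ∑ i ∈ I ∪ J, a i = f (I ∪ J) ∧ ∑ i ∈ I ∩ J, a i = f (I ∩ J) := by
  have h1 := hf I J
  have h2 := ha (I ∪ J)
  have h3 := ha (I ∩ J)
  have h4 := Finset.sum_union_inter (s₁ := I) (s₂ := J) (f := a)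
  constructor <;> linarith

variable [Fintype ι]

/-- A failing exchange is witnessed by a tight set separating the two coordinates. -/
theorem exists_tight_of_move_notMem {f : Finset ι → ℤ} {a : ι → ℤ}
    (ha : ∀ I : Finset ι, ∑ i ∈ I, a i ≤ f I) (ha' : ∑ i, a i = f Finset.univ) {i j : ι}
    (h : ¬ ((∀ I : Finset ι, ∑ k ∈ I, (a + Pi.single i 1 - Pi.single j 1 : ι → ℤ) k ≤ f I) ∧
      ∑ k, (a + Pi.single i 1 - Pi.single j 1 : ι → ℤ) k = f Finset.univ)) :
    ∃ T : Finset ι, ∑ k ∈ T, a k = f T ∧ i ∈ T ∧ j ∉ T := by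
  have hsum : ∀ I : Finset ι, ∑ k ∈ I, (a + Pi.single i 1 - Pi.single j 1 : ι → ℤ) k =
      ∑ k ∈ I, a k + (if i ∈ I then 1 else 0) - (if j ∈ I then 1 else 0) := by
    intro I
    simp only [Pi.add_apply, Pi.sub_apply, Finset.sum_sub_distrib, Finset.sum_add_distrib,
      Finset.sum_pi_single']
  simp only [hsum, Finset.mem_univ, if_true, add_sub_cancel_right, ha', and_true, not_forall,
    not_le] at h
  obtain ⟨T, hT⟩ := h
  have := ha T
  refine ⟨T, ?_⟩
  split_ifs at hT with h1 h2 h2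
  · omega
  · exact ⟨by omega, h1, h2⟩
  · omega
  · omega

/-- If every exchange failed, intersecting (for `up`) or uniting (for `down`) the separating tight
sets would give one tight set that separates `i` from all candidates `j`. Comparing the sums of `a`
and `b` over it contradicts the rank bound for `b`. -/
theorem IsPolymatroid.isExchangeSet {P : Set (ι → ℤ)} (hP : IsPolymatroid P) :
    IsExchangeSet hP.finite.toFinset := by
  suffices h : ∀ Q : Finset (ι → ℤ), (Q : Set (ι → ℤ)) = P → IsExchangeSet Q from
    h _ hP.finite.coe_toFinset
  intro Q hQ
  obtain ⟨f, h0, hf, rfl⟩ := hP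
  have hmem : ∀ a, a ∈ Q ↔ (∀ I : Finset ι, ∑ i ∈ I, a i ≤ f I) ∧ ∑ i, a i = f Finset.univ := by
    intro a
    rw [← Finset.mem_coe, hQ]
    rfl
  constructor
  · intro a ha b hb i hi
    rw [hmem] at ha hb
    by_contra! hcon
    have key : ∀ S : Finset ι, (∀ j ∈ S, b j < a j) →
        ∃ T : Finset ι, ∑ k ∈ T, a k = f T ∧ i ∈ T ∧ ∀ j ∈ S, j ∉ T := by
      intro S
      induction S using Finset.induction_on with
      | empty => exact fun _ => ⟨Finset.univ, ha.2, Finset.mem_univ _, by simp⟩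
      | insert j S _ ih =>
        intro hS
        obtain ⟨T, hT, hiT, hST⟩ := ih fun k hk => hS k (Finset.mem_insert_of_mem hk)
        have hj := hcon j (hS j (Finset.mem_insert_self _ _))
        rw [hmem] at hj
        obtain ⟨U, hU, hiU, hjU⟩ := exists_tight_of_move_notMem ha.1 ha.2 hj
        refine ⟨T ∩ U, (tight_union_inter hf ha.1 hT hU).2, Finset.mem_inter.2 ⟨hiT, hiU⟩, ?_⟩
        intro k hk hkTU
        rw [Finset.mem_inter] at hkTU
        rcases Finset.mem_insert.1 hk with rfl | hk
        · exact hjU hkTU.2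
        · exact hST k hk hkTU.1
    obtain ⟨T, hT, hiT, hST⟩ := key (Finset.univ.filter fun j => b j < a j) (by simp)
    have hlt : ∑ k ∈ T, a k < ∑ k ∈ T, b k := by
      refine Finset.sum_lt_sum (fun k hk => ?_) ⟨i, hiT, hi⟩
      by_contra! hk'
      exact hST k (by simpa using hk') hk
    have := hb.1 T
    omega
  · intro a ha b hb i hi
    rw [hmem] at ha hb
    by_contra! hcon
    have key : ∀ S : Finset ι, (∀ j ∈ S, a j < b j) →
        ∃ T : Finset ι, ∑ k ∈ T, a k = f T ∧ i ∉ T ∧ ∀ j ∈ S, j ∈ T := by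
      intro S
      induction S using Finset.induction_on with
      | empty => exact fun _ => ⟨∅, by simp [h0], Finset.notMem_empty _, by simp⟩
      | insert j S _ ih =>
        intro hS
        obtain ⟨T, hT, hiT, hST⟩ := ih fun k hk => hS k (Finset.mem_insert_of_mem hk)
        have hj := hcon j (hS j (Finset.mem_insert_self _ _))
        rw [sub_add_single, hmem] at hj
        obtain ⟨U, hU, hjU, hiU⟩ := exists_tight_of_move_notMem ha.1 ha.2 hj
        refine ⟨T ∪ U, (tight_union_inter hf ha.1 hT hU).1, by simp [hiT, hiU], ?_⟩
        intro k hk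
        rw [Finset.mem_union]
        rcases Finset.mem_insert.1 hk with rfl | hk
        · exact Or.inr hjU
        · exact Or.inl (hST k hk)
    obtain ⟨T, hT, hiT, hST⟩ := key (Finset.univ.filter fun j => a j < b j) (by simp)
    -- Total sums agree, so a smaller sum of `b` off `T` means a sum above `f T` on `T`.
    have hlt : ∑ k ∈ Tᶜ, b k < ∑ k ∈ Tᶜ, a k := by
      refine Finset.sum_lt_sum (fun k hk => ?_) ⟨i, by simpa using hiT, hi⟩
      by_contra! hk'
      exact Finset.mem_compl.1 hk (hST k (by simpa using hk'))
    have h1 := hb.1 T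
    have h2 := Finset.sum_add_sum_compl T a
    have h3 := Finset.sum_add_sum_compl T b
    omega

end Polymatroid

/-! ### Return to interior and exterior polynomials. -/

section Polynomials

variable {ι : Type*} [Fintype ι] [LinearOrder ι]

open Classical in
theorem exteriorPolynomial_eq_listPolynomial (P : Finset (ι → ℤ)) {L : List ι}
    (hL : L.Pairwise (· > ·)) (hmem : ∀ i, i ∈ L) :
    exteriorPolynomial (P : Set (ι → ℤ)) = listPolynomial P L := by
  rw [exteriorPolynomial, finsum_mem_coe_finset, listPolynomial]
  refine Finset.sum_congr rfl fun a _ => ?_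
  have hext : (externallyActive (P : Set (ι → ℤ)) a)ᶜ = (L.toFinset.filter fun i =>
      ∃ j ∈ L, j < i ∧ a + Pi.single i 1 - Pi.single j 1 ∈ P : Finset ι) := by
    ext i
    simp [externallyActive, hmem]
  have hcard := Set.ncard_add_ncard_compl (externallyActive (P : Set (ι → ℤ)) a)
  rw [hext, Set.ncard_coe_finset, Nat.card_eq_fintype_card] at hcard
  rw [passiveCount_eq_card P a hL, ← hcard, Nat.add_sub_cancel_left]
  congr!

theorem interiorPolynomial_eq_exteriorPolynomial_neg (P : Set (ι → ℤ)) :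
    interiorPolynomial P = exteriorPolynomial {a | -a ∈ P} := by
  rw [interiorPolynomial, exteriorPolynomial]
  refine finsum_mem_eq_of_bijOn (fun a => -a) ⟨fun a ha => by simpa using ha,
    neg_injective.injOn, fun a ha => ⟨-a, ha, neg_neg a⟩⟩ fun a _ => ?_
  congr 3
  ext i
  simp only [internallyActive, externallyActive, Set.mem_ofPred_eq]
  refine forall₂_congr fun j _ => ?_
  rw [show -(-a + Pi.single i 1 - Pi.single j 1) = a - Pi.single i 1 + Pi.single j 1 by abel]

theorem IsExchangeSet.coeff_exteriorPolynomial_mono {P Q : Finset (ι → ℤ)}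
    (hP : IsExchangeSet P) (hQ : IsExchangeSet Q) (hQP : Q ⊆ P) (k : ℕ) :
    (exteriorPolynomial (Q : Set (ι → ℤ))).coeff k ≤
      (exteriorPolynomial (P : Set (ι → ℤ))).coeff k := by
  obtain ⟨L, hL, hmem⟩ : ∃ L : List ι, L.Pairwise (· > ·) ∧ ∀ i, i ∈ L :=
    ⟨Finset.univ.sort (· ≥ ·), (Finset.sortedGT_sort _).pairwise, by simp⟩
  rw [exteriorPolynomial_eq_listPolynomial P hL hmem,
    exteriorPolynomial_eq_listPolynomial Q hL hmem]
  exact coeff_listPolynomial_mono _ L rfl (hL.imp ne_of_gt) P Q hP hQ hQP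
    (fun _ _ _ _ i hi => absurd (hmem i) hi) k

end Polynomials

theorem theorem4p2 (n : ℕ) (P P' : Set (Fin n → ℤ)) (hP : IsPolymatroid P)
    (hP' : IsPolymatroid P') (hsub : P' ⊆ P) :
    (∀ k : ℕ, (interiorPolynomial P').coeff k ≤ (interiorPolynomial P).coeff k) ∧
    (∀ k : ℕ, (exteriorPolynomial P').coeff k ≤ (exteriorPolynomial P).coeff k) := by
  have hE := hP.isExchangeSet
  have hE' := hP'.isExchangeSet
  have hPQ : hP'.finite.toFinset ⊆ hP.finite.toFinset := Set.Finite.toFinset_mono hsub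
  constructor
  · have hneg : ∀ {S : Set (Fin n → ℤ)} (hS : IsPolymatroid S) (a : Fin n → ℤ),
        a ∈ hS.finite.toFinset.map (Equiv.neg _).toEmbedding ↔ -a ∈ hS.finite.toFinset := by
      intro S hS a
      simp only [Finset.mem_map_equiv]
      rfl
    have hcoe : ∀ {S : Set (Fin n → ℤ)} (hS : IsPolymatroid S), {a | -a ∈ S} =
        (hS.finite.toFinset.map (Equiv.neg _).toEmbedding : Set (Fin n → ℤ)) := by
      intro S hS
      ext a
      rw [Finset.mem_coe, hneg hS, Set.Finite.mem_toFinset]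
      rfl
    rw [interiorPolynomial_eq_exteriorPolynomial_neg, interiorPolynomial_eq_exteriorPolynomial_neg,
      hcoe hP, hcoe hP']
    exact (hE.neg (hneg hP)).coeff_exteriorPolynomial_mono (hE'.neg (hneg hP'))
      (Finset.map_subset_map.2 hPQ)
  · have := hE.coeff_exteriorPolynomial_mono hE' hPQ
    rwa [Set.Finite.coe_toFinset, Set.Finite.coe_toFinset] at this
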